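/- Let $\kappa$ be an infinite cardinal. A Hilbert space is called $\kappa$-separable if it admits an orthonormal basis of cardinality $<\kappa$. A von Neumann algebra is called $\kappa$-separable if it admits a faithful normal unital $*$-representation on a $\kappa$-separable Hilbert space. A module over a von Neumann algebra $A$ is a Hilbert space $H$ together with a normal unital $*$-homomorphism $A\to B(H)$; it is called $\kappa$-small if its endomorphism algebra $\mathrm{End}_A(H)$, that is, the commutant in $B(H)$ of the image of $A$, is a $\kappa$-separable von Neumann algebra. (i) If $A$ is a $\kappa$-separable von Neumann algebra, then an $A$-module is $\kappa$-small if and only if its underlying Hilbert space is $\kappa$-separable. (ii) Let $A=\prod_{i\in I}A_i$ be a product of $\kappa$-separable von Neumann algebras $A_i\subset B(K_i)$, where $I$ is an arbitrary set and the product is the von Neumann algebra on $\bigoplus_{i\in I}K_i$ generated by the algebraic direct sum of the $A_i$. Then every $A$-module whose underlying Hilbert space is $\kappa$-separable is $\kappa$-small. If moreover the cardinal $\kappa$ is regular, then, conversely, the underlying Hilbert space of every $\kappa$-small $A$-module is $\kappa$-separable; so for regular $\kappa$ an $A$-module is $\kappa$-small if and only if its underlying Hilbert space is $\kappa$-separable.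 -/

import Mathlib

open scoped Cardinal ENNReal

universe u

/-- A Hilbert space is `κ`-separable if it admits an (orthonormal) Hilbert basis of cardinality
`< κ`. -/
def IsKappaSeparableHilbert (κ : Cardinal.{u}) (H : Type u) [NormedAddCommGroup H]
    [InnerProductSpace ℂ H] [CompleteSpace H] : Prop :=
  ∃ ι : Type u, #ι < κ ∧ Nonempty (HilbertBasis ι ℂ H)

namespace VonNeumannAlgebra

section Modules

variable {K : Type u} [NormedAddCommGroup K] [InnerProductSpace ℂ K] [CompleteSpace K]
variable {H : Type u} [NormedAddCommGroup H] [InnerProductSpace ℂ H] [CompleteSpace H]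

/-- A map from a von Neumann algebra `A ⊆ B(K)` to `B(H)` is normal if it preserves suprema of
bounded increasing nets of positive elements, i.e. of nonempty upward directed sets of positive
elements that have a supremum. Both `A` and `B(H)` carry the usual (Loewner) order of operators:
`a ≤ b` if and only if `b - a` is positive. -/
def IsNormal (A : VonNeumannAlgebra K) (f : A.toStarSubalgebra → (H →L[ℂ] H)) : Prop :=
  ∀ D : Set A.toStarSubalgebra, D.Nonempty → DirectedOn (· ≤ ·) D → (∀ a ∈ D, 0 ≤ a) →
    ∀ s : A.toStarSubalgebra, IsLUB D s → IsLUB (f '' D) (f s)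

variable (H) in
/-- A module structure on the Hilbert space `H` over a von Neumann algebra `A`: a normal unital
`*`-homomorphism `A → B(H)`. -/
structure NormalModule (A : VonNeumannAlgebra K) where
  /-- The action of `A` on `H`. -/
  action : A.toStarSubalgebra →⋆ₐ[ℂ] (H →L[ℂ] H)
  isNormal : A.IsNormal action

/-- A von Neumann algebra is `κ`-separable if it admits a faithful (normal) representation on a
`κ`-separable Hilbert space. -/
def IsKappaSeparable (κ : Cardinal.{u}) (A : VonNeumannAlgebra K) : Prop :=
  ∃ (L : Type u) (_ : NormedAddCommGroup L) (_ : InnerProductSpace ℂ L) (_ : CompleteSpace L)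
    (M : NormalModule L A), Function.Injective M.action ∧ IsKappaSeparableHilbert κ L

/-- The commutant of a set `S` of operators and their adjoints, as a von Neumann algebra. -/
noncomputable def commutantOf (S : Set (H →L[ℂ] H)) : VonNeumannAlgebra H where
  toStarSubalgebra := StarSubalgebra.centralizer ℂ S
  centralizer_centralizer' := by
    change Set.centralizer (Set.centralizer (Set.centralizer (S ∪ star S))) =
      Set.centralizer (S ∪ star S)
    simp

/-- The von Neumann algebra generated by a set `S` of operators: the double commutant
of `S ∪ S*`. -/
noncomputable def generatedBy (S : Set (H →L[ℂ] H)) : VonNeumannAlgebra H :=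
  commutantOf (commutantOf S : Set (H →L[ℂ] H))

/-- The endomorphism algebra of an `A`-module `H`: all bounded operators on `H` that commute with
the action of `A`. -/
noncomputable def NormalModule.endAlgebra {A : VonNeumannAlgebra K} (M : NormalModule H A) :
    VonNeumannAlgebra H :=
  commutantOf (Set.range M.action)

theorem NormalModule.mem_endAlgebra_iff {A : VonNeumannAlgebra K} (M : NormalModule H A)
    (T : H →L[ℂ] H) :
    T ∈ M.endAlgebra ↔ ∀ (a : A.toStarSubalgebra) (x : H), T (M.action a x) = M.action a (T x) := by
  have h1 : T ∈ M.endAlgebra ↔ T ∈ StarSubalgebra.centralizer ℂ (Set.range M.action) := Iff.rfl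
  rw [h1, StarSubalgebra.mem_centralizer_iff]
  constructor
  · intro h a x
    exact (congrArg (fun S : H →L[ℂ] H => S x) (h _ ⟨a, rfl⟩).1).symm
  · rintro h _ ⟨a, rfl⟩
    refine ⟨?_, ?_⟩
    · ext x
      exact (h a x).symm
    · rw [← map_star]
      ext x
      exact (h (star a) x).symm

/-- An object of the category of `A`-modules is `κ`-small if its endomorphism algebra is
`κ`-separable. -/
def NormalModule.IsKappaSmall (κ : Cardinal.{u}) {A : VonNeumannAlgebra K}
    (M : NormalModule H A) : Prop :=
  M.endAlgebra.IsKappaSeparable κ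

end Modules

section Product

variable {I : Type u} {K : I → Type u} [∀ i, NormedAddCommGroup (K i)]
  [∀ i, InnerProductSpace ℂ (K i)] [∀ i, CompleteSpace (K i)]

open Classical in
/-- The inclusion of the `i`-th summand into the Hilbert space direct sum `⨁ K i`. -/
noncomputable def summandInclusion (i : I) : K i →L[ℂ] lp K 2 :=
  lp.singleContinuousLinearMap ℂ K 2 i

/-- The operator on `⨁ K i` that acts as `a` on the `i`-th summand and as `0` on all others. -/
noncomputable def blockOperator (i : I) (a : K i →L[ℂ] K i) : lp K 2 →L[ℂ] lp K 2 :=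
  summandInclusion i ∘L a ∘L ContinuousLinearMap.adjoint (summandInclusion i)

open Classical in
theorem blockOperator_apply (i : I) (a : K i →L[ℂ] K i) (x : lp K 2) :
    blockOperator i a x = lp.single 2 i (a (x i)) := by
  have h : ContinuousLinearMap.adjoint (summandInclusion (K := K) i) x = x i := by
    refine ext_inner_left ℂ fun v => ?_
    rw [ContinuousLinearMap.adjoint_inner_right]
    exact lp.inner_single_left i v x
  change lp.single 2 i (a (ContinuousLinearMap.adjoint (summandInclusion (K := K) i) x)) = _
  rw [h]

/-- The product of the von Neumann algebras `A i ⊆ B(K i)`: the von Neumann algebra on `⨁ K i`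
generated by the algebraic direct sum of the `A i`. -/
noncomputable def product (A : ∀ i, VonNeumannAlgebra (K i)) : VonNeumannAlgebra (lp K 2) :=
  generatedBy (⋃ i, blockOperator i '' (A i : Set (K i →L[ℂ] K i)))

end Product

end VonNeumannAlgebra

/-! If `H` is `κ`-separable, then so is the endomorphism algebra, because it acts faithfully and
normally on `H` itself. This needs no assumption on `A`.

Conversely, Zorn's lemma splits `H` into an orthogonal sum of cyclic submodules
(`exists_cyclic_decomposition`). The projections onto them are nonzero, pairwise orthogonal elements
of the endomorphism algebra, so a small module has fewer than `κ` summands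
(`IsKappaSeparable.mk_lt`).

The dimension of each summand is controlled by choosing its generator well. Given a normal
representation `R` of `A`, faithful below some `p` that is visible to the vector state of `ξ`,
`exists_norm_action_le` compares this state with a vector state of `R` and finds `x` and `η` with `x
ξ ≠ 0` and `‖a x ξ‖ ≤ ‖R(a) R(x) η‖` for all `a`. Then `R(a) R(x) η ↦ a x ξ` extends to a bounded
operator with dense range in the cyclic submodule, and such operators do not raise Hilbert
dimension.

In (i), one faithful `R` bounds all the dimensions at once, and a product of two cardinals below the
infinite `κ` stays below `κ`. In (ii), the central projections of the factors have supremum 1, so by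
normality one of them is visible to any given nonzero vector, and `R` is pulled back from that
factor. The bounds now vary with the factor, and regularity of `κ` is what bounds their sum. -/

open Filter Topology

/-! ### Quadratic forms and suprema of positive operators -/

section BoundedMonotoneNets

variable {H : Type*} [NormedAddCommGroup H] [InnerProductSpace ℂ H] [CompleteSpace H]

theorem ContinuousLinearMap.nonneg_iff_re_inner {T : H →L[ℂ] H} (hT : IsSelfAdjoint T) :
    0 ≤ T ↔ ∀ v, 0 ≤ (inner ℂ (T v) v).re := by
  rw [ContinuousLinearMap.nonneg_iff_isPositive, ContinuousLinearMap.isPositive_iff']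
  constructor
  · rintro ⟨-, h⟩ v
    exact (Complex.nonneg_iff.1 (h v)).1
  · intro h
    refine ⟨hT, fun v => ?_⟩
    have := ((ContinuousLinearMap.isPositive_def' (T := T)).2 ⟨hT, h⟩).inner_nonneg_left v
    exact this

theorem ContinuousLinearMap.re_inner_nonneg {T : H →L[ℂ] H} (hT : 0 ≤ T) (v : H) :
    0 ≤ (inner ℂ (T v) v).re :=
  (ContinuousLinearMap.nonneg_iff_re_inner (IsSelfAdjoint.of_nonneg hT)).1 hT v

theorem ContinuousLinearMap.re_inner_mono {S T : H →L[ℂ] H} (h : S ≤ T) (v : H) :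
    (inner ℂ (S v) v).re ≤ (inner ℂ (T v) v).re := by
  have := ContinuousLinearMap.re_inner_nonneg (sub_nonneg.2 h) v
  simp only [sub_apply, inner_sub_left, Complex.sub_re] at this
  linarith

theorem ContinuousLinearMap.le_of_re_inner_le {a b : H →L[ℂ] H} (ha : IsSelfAdjoint a)
    (hb : IsSelfAdjoint b) (h : ∀ v, (inner ℂ (a v) v).re ≤ (inner ℂ (b v) v).re) : a ≤ b := by
  rw [← sub_nonneg, ContinuousLinearMap.nonneg_iff_re_inner (hb.sub ha)]
  intro v
  simpa [inner_sub_left] using h v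

/-- Write `T = S* S`; then `‖S* S v‖² ≤ ‖S‖² ‖S v‖²`. This turns convergence of quadratic forms into
strong convergence. -/
theorem ContinuousLinearMap.norm_apply_sq_le_of_nonneg {T : H →L[ℂ] H} (hT : 0 ≤ T) (v : H) :
    ‖T v‖ ^ 2 ≤ ‖T‖ * (inner ℂ (T v) v).re := by
  obtain ⟨S, rfl⟩ := CStarAlgebra.nonneg_iff_eq_star_mul_self.1 hT
  have h1 : ((inner ℂ ((star S * S) v) v).re : ℝ) = ‖S v‖ ^ 2 := by
    rw [mul_apply_eq_comp, ContinuousLinearMap.star_eq_adjoint,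
      ContinuousLinearMap.adjoint_inner_left, ← inner_self_eq_norm_sq (𝕜 := ℂ)]
    rfl
  rw [h1, CStarRing.norm_star_mul_self]
  have h2 : ‖(star S * S) v‖ ≤ ‖S‖ * ‖S v‖ := by
    have := (star S).le_opNorm (S v)
    rwa [norm_star] at this
  calc ‖(star S * S) v‖ ^ 2 ≤ (‖S‖ * ‖S v‖) ^ 2 := by gcongr
    _ = _ := by ring

/-- A bounded increasing net of positive operators converges strongly to its supremum. -/
theorem ContinuousLinearMap.exists_isLUB_tendsto {D : Set (H →L[ℂ] H)} (hne : D.Nonempty)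
    (hdir : DirectedOn (· ≤ ·) D) (hpos : ∀ a ∈ D, 0 ≤ a) {t : H →L[ℂ] H}
    (ht : t ∈ upperBounds D) :
    ∃ s : H →L[ℂ] H, IsLUB D s ∧
      ∀ v, Tendsto (fun d : D => (d : H →L[ℂ] H) v) atTop (𝓝 (s v)) := by
  have : Nonempty D := hne.to_subtype
  have : IsDirectedOrder D := ⟨fun a b => by
    obtain ⟨c, hc, hac, hbc⟩ := hdir a a.2 b b.2
    exact ⟨⟨c, hc⟩, hac, hbc⟩⟩
  have hnorm : ∀ a b : D, a ≤ b → ‖(b : H →L[ℂ] H) - a‖ ≤ ‖t‖ := fun a b hab =>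
    CStarAlgebra.norm_le_norm_of_nonneg_of_le (sub_nonneg.2 hab)
      ((sub_le_self _ (hpos a a.2)).trans (ht b.2))
  have hcauchy : ∀ v, ∃ w, Tendsto (fun d : D => (d : H →L[ℂ] H) v) atTop (𝓝 w) := by
    intro v
    obtain ⟨L, hL⟩ : ∃ L, Tendsto (fun d : D => (inner ℂ ((d : H →L[ℂ] H) v) v).re) atTop (𝓝 L) :=
      ⟨_, tendsto_atTop_ciSup (fun a b hab => ContinuousLinearMap.re_inner_mono hab v)
        ⟨(inner ℂ (t v) v).re, by
          rintro _ ⟨d, rfl⟩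
          exact ContinuousLinearMap.re_inner_mono (ht d.2) v⟩⟩
    have hmono : ∀ d : D, (inner ℂ ((d : H →L[ℂ] H) v) v).re ≤ L := fun d =>
      Monotone.ge_of_tendsto (f := fun d : D => (inner ℂ ((d : H →L[ℂ] H) v) v).re)
      (fun a b hab => ContinuousLinearMap.re_inner_mono hab v) hL d
    refine cauchy_map_iff_exists_tendsto.1 (Metric.cauchy_iff.2 ⟨inferInstance, fun ε hε => ?_⟩)
    -- The quotient makes the estimate of the squared norm come out as `(ε / 2) ^ 2`; the `+ 1`
    -- covers `t = 0`.
    have hδ : 0 < (ε / 2) ^ 2 / (‖t‖ + 1) := by positivity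
    obtain ⟨d₀, hd₀⟩ := ((tendsto_order.1 hL).1 _ (sub_lt_self L hδ)).exists
    have key : ∀ d : D, d₀ ≤ d → ‖(d : H →L[ℂ] H) v - (d₀ : H →L[ℂ] H) v‖ < ε / 2 := by
      intro d hd
      have h1 := ContinuousLinearMap.norm_apply_sq_le_of_nonneg (sub_nonneg.2 hd :
        (0 : H →L[ℂ] H) ≤ (d : H →L[ℂ] H) - d₀) v
      have h0 := ContinuousLinearMap.re_inner_nonneg (sub_nonneg.2 hd :
        (0 : H →L[ℂ] H) ≤ (d : H →L[ℂ] H) - d₀) v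
      have h2 : (inner ℂ (((d : H →L[ℂ] H) - d₀) v) v).re < (ε / 2) ^ 2 / (‖t‖ + 1) := by
        have := hmono d
        simp only [sub_apply, inner_sub_left, Complex.sub_re]
        linarith
      have h3 : ‖((d : H →L[ℂ] H) - d₀) v‖ ^ 2 < (ε / 2) ^ 2 := by
        calc _ ≤ _ := h1
          _ ≤ (‖t‖ + 1) * (inner ℂ (((d : H →L[ℂ] H) - d₀) v) v).re := by
            gcongr
            linarith [hnorm d₀ d hd]
          _ < (‖t‖ + 1) * ((ε / 2) ^ 2 / (‖t‖ + 1)) := by gcongr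
          _ = (ε / 2) ^ 2 := by field_simp
      rw [← sub_apply]
      exact lt_of_pow_lt_pow_left₀ 2 (by positivity) h3
    refine ⟨_, image_mem_map (Ici_mem_atTop d₀), ?_⟩
    rintro _ ⟨a, ha, rfl⟩ _ ⟨b, hb, rfl⟩
    have := dist_triangle_right ((a : H →L[ℂ] H) v) ((b : H →L[ℂ] H) v) ((d₀ : H →L[ℂ] H) v)
    rw [dist_eq_norm ((a : H →L[ℂ] H) v) ((d₀ : H →L[ℂ] H) v),
      dist_eq_norm ((b : H →L[ℂ] H) v) ((d₀ : H →L[ℂ] H) v)] at this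
    linarith [key a ha, key b hb]
  choose g hg using hcauchy
  have hb : ∀ d : D, ‖(d : H →L[ℂ] H)‖ ≤ ‖t‖ := fun d =>
    CStarAlgebra.norm_le_norm_of_nonneg_of_le (hpos d d.2) (ht d.2)
  let l : H →ₗ[ℂ] H := linearMapOfTendsto g (fun d : D => ((d : H →L[ℂ] H) : H →ₗ[ℂ] H))
    (tendsto_pi_nhds.2 hg)
  let s : H →L[ℂ] H := l.mkContinuous ‖t‖ fun v =>
    le_of_tendsto' ((hg v).norm) fun d => (d : H →L[ℂ] H).le_of_opNorm_le (hb d) v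
  have hs : ∀ v, Tendsto (fun d : D => (d : H →L[ℂ] H) v) atTop (𝓝 (s v)) := hg
  have hsa : IsSelfAdjoint s := by
    rw [ContinuousLinearMap.isSelfAdjoint_iff_isSymmetric]
    intro v w
    refine tendsto_nhds_unique ((hs v).inner tendsto_const_nhds) ?_
    refine (tendsto_const_nhds.inner (hs w)).congr fun d => ?_
    exact (((ContinuousLinearMap.nonneg_iff_isPositive _).1
      (hpos d d.2)).inner_left_eq_inner_right v w).symm
  have hre : ∀ v, Tendsto (fun d : D => (inner ℂ ((d : H →L[ℂ] H) v) v).re) atTop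
      (𝓝 (inner ℂ (s v) v).re) := fun v =>
    (Complex.continuous_re.tendsto _).comp ((hs v).inner tendsto_const_nhds)
  refine ⟨s, ⟨fun d hd => ?_, fun r hr => ?_⟩, hs⟩
  · refine ContinuousLinearMap.le_of_re_inner_le (IsSelfAdjoint.of_nonneg (hpos d hd)) hsa fun v => ?_
    exact Monotone.ge_of_tendsto (f := fun d : D => (inner ℂ ((d : H →L[ℂ] H) v) v).re)
      (fun a b hab => ContinuousLinearMap.re_inner_mono hab v) (hre v) ⟨d, hd⟩
  · obtain ⟨d, hd⟩ := hne
    refine ContinuousLinearMap.le_of_re_inner_le hsa (IsSelfAdjoint.of_nonneg ((hpos d hd).trans (hr hd))) fun v => ?_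
    exact le_of_tendsto' (hre v) fun d => ContinuousLinearMap.re_inner_mono (hr d.2) v

/-- The quadratic form of a supremum of positive operators is the supremum of the quadratic
forms. -/
theorem ContinuousLinearMap.isLUB_re_inner {D : Set (H →L[ℂ] H)} (hne : D.Nonempty)
    (hdir : DirectedOn (· ≤ ·) D) (hpos : ∀ a ∈ D, 0 ≤ a) {s : H →L[ℂ] H} (hs : IsLUB D s)
    (v : H) : IsLUB ((fun a : H →L[ℂ] H => (inner ℂ (a v) v).re) '' D) (inner ℂ (s v) v).re := by
  obtain ⟨s', hs', ht⟩ := ContinuousLinearMap.exists_isLUB_tendsto hne hdir hpos hs.1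
  obtain rfl := hs.unique hs'
  have : Nonempty D := hne.to_subtype
  have : IsDirectedOrder D := ⟨fun a b => by
    obtain ⟨c, hc, hac, hbc⟩ := hdir a a.2 b b.2
    exact ⟨⟨c, hc⟩, hac, hbc⟩⟩
  refine ⟨?_, fun r hr => ?_⟩
  · rintro _ ⟨d, hd, rfl⟩
    exact ContinuousLinearMap.re_inner_mono (hs.1 hd) v
  · exact le_of_tendsto' ((Complex.continuous_re.tendsto _).comp
      ((ht v).inner tendsto_const_nhds)) fun d => hr ⟨d, d.2, rfl⟩

theorem ContinuousLinearMap.isLUB_of_isLUB_re_inner {D : Set (H →L[ℂ] H)} (hne : D.Nonempty)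
    (hpos : ∀ a ∈ D, 0 ≤ a) {s : H →L[ℂ] H} (hsa : IsSelfAdjoint s)
    (h : ∀ v, IsLUB ((fun a : H →L[ℂ] H => (inner ℂ (a v) v).re) '' D) (inner ℂ (s v) v).re) :
    IsLUB D s := by
  refine ⟨fun d hd => ?_, fun r hr => ?_⟩
  · exact ContinuousLinearMap.le_of_re_inner_le (IsSelfAdjoint.of_nonneg (hpos d hd)) hsa fun v => (h v).1 ⟨d, hd, rfl⟩
  · obtain ⟨d, hd⟩ := hne
    refine ContinuousLinearMap.le_of_re_inner_le hsa (IsSelfAdjoint.of_nonneg ((hpos d hd).trans (hr hd))) fun v => (h v).2 ?_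
    rintro _ ⟨d, hd, rfl⟩
    exact ContinuousLinearMap.re_inner_mono (hr hd) v

end BoundedMonotoneNets

namespace VonNeumannAlgebra

/-! ### Normal modules and comparison of vector states -/

section Normal

variable {K : Type u} [NormedAddCommGroup K] [InnerProductSpace ℂ K] [CompleteSpace K]
variable {H : Type u} [NormedAddCommGroup H] [InnerProductSpace ℂ H] [CompleteSpace H]
variable {A : VonNeumannAlgebra K}

theorem coe_image_directedOn {D : Set A.toStarSubalgebra} (hdir : DirectedOn (· ≤ ·) D) :
    DirectedOn (· ≤ ·) ((fun a : A.toStarSubalgebra => (a : K →L[ℂ] K)) '' D) := by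
  rintro _ ⟨a, ha, rfl⟩ _ ⟨b, hb, rfl⟩
  obtain ⟨c, hc, hac, hbc⟩ := hdir a ha b hb
  exact ⟨c, ⟨c, hc, rfl⟩, hac, hbc⟩

/-- A von Neumann algebra is closed under suprema of bounded directed sets of positive
operators. -/
theorem exists_isLUB_coe {D : Set A.toStarSubalgebra} (hne : D.Nonempty)
    (hdir : DirectedOn (· ≤ ·) D) (hpos : ∀ a ∈ D, 0 ≤ a) {t : A.toStarSubalgebra}
    (ht : t ∈ upperBounds D) :
    ∃ s : A.toStarSubalgebra, IsLUB D s ∧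
      IsLUB ((fun a : A.toStarSubalgebra => (a : K →L[ℂ] K)) '' D) (s : K →L[ℂ] K) := by
  have hne' := hne.image (fun a : A.toStarSubalgebra => (a : K →L[ℂ] K))
  have hdir' := coe_image_directedOn hdir
  obtain ⟨s, hs, hlim⟩ := ContinuousLinearMap.exists_isLUB_tendsto hne' hdir'
    (by rintro _ ⟨a, ha, rfl⟩; exact hpos a ha) (t := t)
    (by rintro _ ⟨a, ha, rfl⟩; exact ht ha)
  have hsA : s ∈ A := by
    have : Nonempty ((fun a : A.toStarSubalgebra => (a : K →L[ℂ] K)) '' D) := hne'.to_subtype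
    have : IsDirectedOrder ((fun a : A.toStarSubalgebra => (a : K →L[ℂ] K)) '' D) :=
      ⟨fun a b => by
        obtain ⟨c, hc, hac, hbc⟩ := hdir' a a.2 b b.2
        exact ⟨⟨c, hc⟩, hac, hbc⟩⟩
    -- A strong limit of elements of `A` still commutes with the commutant of `A`.
    rw [← commutant_commutant A, mem_commutant_iff]
    intro g hg
    ext v
    rw [mul_apply_eq_comp, mul_apply_eq_comp]
    refine tendsto_nhds_unique ((g.continuous.tendsto _).comp (hlim v)) ?_
    refine (hlim (g v)).congr ?_
    rintro ⟨_, a, ha, rfl⟩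
    exact congrArg (fun S : K →L[ℂ] K => S v) ((mem_commutant_iff.1 hg a a.2))
  refine ⟨⟨s, hsA⟩, ⟨fun a ha => hs.1 ⟨a, ha, rfl⟩, fun b hb => hs.2 ?_⟩, hs⟩
  rintro _ ⟨a, ha, rfl⟩
  exact hb ha

theorem isLUB_coe {D : Set A.toStarSubalgebra} (hne : D.Nonempty)
    (hdir : DirectedOn (· ≤ ·) D) (hpos : ∀ a ∈ D, 0 ≤ a) {s : A.toStarSubalgebra}
    (hs : IsLUB D s) :
    IsLUB ((fun a : A.toStarSubalgebra => (a : K →L[ℂ] K)) '' D) (s : K →L[ℂ] K) := by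
  obtain ⟨s', hs', h⟩ := exists_isLUB_coe hne hdir hpos hs.1
  obtain rfl := hs.unique hs'
  exact h

theorem isLUB_re_inner {D : Set A.toStarSubalgebra} (hne : D.Nonempty)
    (hdir : DirectedOn (· ≤ ·) D) (hpos : ∀ a ∈ D, 0 ≤ a) {s : A.toStarSubalgebra}
    (hs : IsLUB D s) (v : K) :
    IsLUB ((fun a : A.toStarSubalgebra => (inner ℂ ((a : K →L[ℂ] K) v) v).re) '' D)
      (inner ℂ ((s : K →L[ℂ] K) v) v).re := by
  have := ContinuousLinearMap.isLUB_re_inner (hne.image _) (coe_image_directedOn hdir)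
    (by rintro _ ⟨a, ha, rfl⟩; exact hpos a ha) (isLUB_coe hne hdir hpos hs) v
  rwa [Set.image_image] at this

/-- The defining representation of a von Neumann algebra, as a module. -/
noncomputable def standardModule (A : VonNeumannAlgebra K) : NormalModule K A where
  action := A.toStarSubalgebra.subtype
  isNormal _ hne hdir hpos _ hs := isLUB_coe hne hdir hpos hs

theorem isKappaSeparable_of_isKappaSeparableHilbert {κ : Cardinal.{u}} (A : VonNeumannAlgebra K)
    (h : IsKappaSeparableHilbert κ K) : A.IsKappaSeparable κ :=
  ⟨K, _, _, _, A.standardModule, Subtype.val_injective, h⟩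

namespace NormalModule

variable (M : NormalModule H A)

/-- Normality applied to the directed set `{a, b}`, whose supremum is `b`. -/
theorem action_mono {a b : A.toStarSubalgebra} (ha : 0 ≤ a) (hab : a ≤ b) :
    M.action a ≤ M.action b := by
  have h := M.isNormal {a, b} ⟨a, by simp⟩ (by
      rintro x hx y hy
      refine ⟨b, by simp, ?_, ?_⟩
      · rcases hx with rfl | rfl
        exacts [hab, le_rfl]
      · rcases hy with rfl | rfl
        exacts [hab, le_rfl])
    (by
      rintro x (rfl | rfl)
      exacts [ha, ha.trans hab]) b
    ⟨by
      rintro x (rfl | rfl)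
      exacts [hab, le_rfl], fun c hc => hc (by simp)⟩
  exact h.1 ⟨a, by simp, rfl⟩

theorem action_nonneg {a : A.toStarSubalgebra} (ha : 0 ≤ a) : 0 ≤ M.action a := by
  simpa using M.action_mono le_rfl ha

/-- The positive functional on `A` given by a vector of a module, restricted to real parts. -/
noncomputable def vectorState (v : H) : A.toStarSubalgebra →ₗ[ℝ] ℝ where
  toFun a := (inner ℂ (M.action a v) v).re
  map_add' a b := by simp
  map_smul' r a := by
    have : r • a = (r : ℂ) • a := rfl
    rw [this, map_smul]
    simp

theorem vectorState_apply (v : H) (a : A.toStarSubalgebra) :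
    M.vectorState v a = (inner ℂ (M.action a v) v).re := rfl

theorem vectorState_nonneg (v : H) {a : A.toStarSubalgebra} (ha : 0 ≤ a) :
    0 ≤ M.vectorState v a :=
  ContinuousLinearMap.re_inner_nonneg (M.action_nonneg ha) v

theorem vectorState_mono (v : H) {a b : A.toStarSubalgebra} (ha : 0 ≤ a) (h : a ≤ b) :
    M.vectorState v a ≤ M.vectorState v b :=
  ContinuousLinearMap.re_inner_mono (M.action_mono ha h) v

theorem vectorState_star_mul_self (v : H) (a : A.toStarSubalgebra) :
    M.vectorState v (star a * a) = ‖M.action a v‖ ^ 2 := by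
  rw [vectorState_apply, map_mul, map_star, mul_apply_eq_comp,
    ContinuousLinearMap.star_eq_adjoint, ContinuousLinearMap.adjoint_inner_left,
    ← inner_self_eq_norm_sq (𝕜 := ℂ)]
  rfl

theorem isLUB_vectorState (v : H) {D : Set A.toStarSubalgebra} (hne : D.Nonempty)
    (hdir : DirectedOn (· ≤ ·) D) (hpos : ∀ a ∈ D, 0 ≤ a) {s : A.toStarSubalgebra}
    (hs : IsLUB D s) : IsLUB (M.vectorState v '' D) (M.vectorState v s) := by
  have := ContinuousLinearMap.isLUB_re_inner (hne.image M.action)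
    (by
      rintro _ ⟨a, ha, rfl⟩ _ ⟨b, hb, rfl⟩
      obtain ⟨c, hc, hac, hbc⟩ := hdir a ha b hb
      exact ⟨_, ⟨c, hc, rfl⟩, M.action_mono (hpos a ha) hac, M.action_mono (hpos b hb) hbc⟩)
    (by rintro _ ⟨a, ha, rfl⟩; exact M.action_nonneg (hpos a ha)) (M.isNormal D hne hdir hpos s hs) v
  rwa [Set.image_image] at this

end NormalModule

/-- Zorn's lemma for sets of positive elements of a von Neumann algebra that are closed under
suprema of chains. -/
theorem exists_maximal_of_chain_closed (S : Set A.toStarSubalgebra) (hne : S.Nonempty)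
    {t : A.toStarSubalgebra} (hpos : ∀ a ∈ S, 0 ≤ a) (ht : ∀ a ∈ S, a ≤ t)
    (hS : ∀ D ⊆ S, D.Nonempty → DirectedOn (· ≤ ·) D → ∀ s, IsLUB D s → s ∈ S) :
    ∃ m, Maximal (· ∈ S) m := by
  obtain ⟨x, hx⟩ := hne
  obtain ⟨m, -, hm⟩ := zorn_le_nonempty₀ S (fun c hc hchain y hy => by
    obtain ⟨s, hs, -⟩ := exists_isLUB_coe ⟨y, hy⟩ hchain.directedOn
      (fun a ha => hpos a (hc ha)) (t := t) (fun a ha => ht a (hc ha))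
    exact ⟨s, hS c hc ⟨y, hy⟩ hchain.directedOn s hs, fun z hz => hs.1 hz⟩) x hx
  exact ⟨m, hm⟩

/-- On quadratic forms, `‖a x v‖² ≤ ‖a‖² ‖x v‖² ≤ ‖a‖² ‖x‖ ⟨x v, v⟩`. Hence domination of states
below `x` controls every `a x`. -/
theorem conj_le_smul {x : A.toStarSubalgebra} (hx : 0 ≤ x) (a : A.toStarSubalgebra) :
    star (a * x) * (a * x) ≤ (‖(a : K →L[ℂ] K)‖ ^ 2 * ‖(x : K →L[ℂ] K)‖) • x := by
  have hsa : IsSelfAdjoint (x : K →L[ℂ] K) := IsSelfAdjoint.of_nonneg hx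
  change star ((a : K →L[ℂ] K) * x) * ((a : K →L[ℂ] K) * x) ≤
    (‖(a : K →L[ℂ] K)‖ ^ 2 * ‖(x : K →L[ℂ] K)‖) • (x : K →L[ℂ] K)
  refine ContinuousLinearMap.le_of_re_inner_le (IsSelfAdjoint.star_mul_self _)
    ((IsSelfAdjoint.all _).smul hsa) fun v => ?_
  have h1 : (inner ℂ ((star ((a : K →L[ℂ] K) * x) * ((a : K →L[ℂ] K) * x)) v) v).re =
      ‖(a : K →L[ℂ] K) ((x : K →L[ℂ] K) v)‖ ^ 2 := by
    rw [mul_apply_eq_comp, ContinuousLinearMap.star_eq_adjoint,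
      ContinuousLinearMap.adjoint_inner_left, ← inner_self_eq_norm_sq (𝕜 := ℂ)]
    rfl
  have h2 : (inner ℂ (((‖(a : K →L[ℂ] K)‖ ^ 2 * ‖(x : K →L[ℂ] K)‖) • (x : K →L[ℂ] K)) v) v).re =
      ‖(a : K →L[ℂ] K)‖ ^ 2 * (‖(x : K →L[ℂ] K)‖ * (inner ℂ ((x : K →L[ℂ] K) v) v).re) := by
    rw [smul_apply, ← Complex.coe_smul, inner_smul_left, Complex.conj_ofReal,
      Complex.re_ofReal_mul, mul_assoc]
  rw [h1, h2]
  calc _ ≤ (‖(a : K →L[ℂ] K)‖ * ‖(x : K →L[ℂ] K) v‖) ^ 2 := by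
        gcongr
        exact (a : K →L[ℂ] K).le_opNorm _
    _ = ‖(a : K →L[ℂ] K)‖ ^ 2 * ‖(x : K →L[ℂ] K) v‖ ^ 2 := by ring
    _ ≤ _ := by
        gcongr
        exact ContinuousLinearMap.norm_apply_sq_le_of_nonneg hx v

variable {L : Type u} [NormedAddCommGroup L] [InnerProductSpace ℂ L] [CompleteSpace L]

/-- If a normal representation `R` is faithful below `p` and `p` does not act by zero on `ξ`, then
some cyclic submodule generated by a nonzero vector `x ξ` is dominated by a cyclic submodule
of `R`. -/
theorem NormalModule.exists_norm_action_le (M : NormalModule H A) (R : NormalModule L A)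
    {p : A.toStarSubalgebra} (hp : 0 ≤ p)
    (hR : ∀ a, 0 ≤ a → a ≤ p → R.action a = 0 → a = 0) {ξ : H} (hξ : M.vectorState ξ p ≠ 0) :
    ∃ (x : A.toStarSubalgebra) (η : L), M.action x ξ ≠ 0 ∧
      ∀ a, ‖M.action a (M.action x ξ)‖ ≤ ‖R.action a (R.action x η)‖ := by
  -- Removing a maximal null element `e` from `p` makes the state of `ξ` faithful below `p - e`.
  obtain ⟨e, ⟨⟨he0, hep, heφ⟩, hemax⟩⟩ := exists_maximal_of_chain_closed
    {a : A.toStarSubalgebra | 0 ≤ a ∧ a ≤ p ∧ M.vectorState ξ a = 0} ⟨0, le_rfl, hp, map_zero _⟩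
    (fun a ha => ha.1) (fun a ha => ha.2.1) (t := p)
    (by
      rintro D hD ⟨d, hd⟩ hdir s hs
      have h0 : 0 ≤ s := (hD hd).1.trans (hs.1 hd)
      refine ⟨h0, hs.2 fun a ha => (hD ha).2.1, le_antisymm ?_ (M.vectorState_nonneg ξ h0)⟩
      refine (M.isLUB_vectorState ξ ⟨d, hd⟩ hdir (fun a ha => (hD ha).1) hs).2 ?_
      rintro _ ⟨a, ha, rfl⟩
      exact (hD ha).2.2.le)
  set x₀ := p - e with hx₀
  have hx₀0 : 0 ≤ x₀ := sub_nonneg.2 hep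
  have hx₀p : x₀ ≤ p := sub_le_self _ he0
  have hfaith : ∀ c, 0 ≤ c → c ≤ x₀ → M.vectorState ξ c = 0 → c = 0 := by
    intro c hc hcx hcφ
    have := hemax (y := e + c) ⟨add_nonneg he0 hc, by
      rw [hx₀, le_sub_iff_add_le'] at hcx; exact hcx, by rw [map_add, heφ, hcφ, add_zero]⟩
      (le_add_of_nonneg_right hc)
    exact le_antisymm (by simpa using this) hc
  have hx₀ne : R.action x₀ ≠ 0 := by
    intro h
    have h1 := hR x₀ hx₀0 hx₀p h
    rw [hx₀, sub_eq_zero] at h1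
    exact hξ (h1 ▸ heφ)
  obtain ⟨ζ, hζ⟩ : ∃ ζ, 0 < R.vectorState ζ x₀ := by
    by_contra! hcon
    refine hx₀ne (le_antisymm ?_ (R.action_nonneg hx₀0))
    refine ContinuousLinearMap.le_of_re_inner_le (IsSelfAdjoint.of_nonneg (R.action_nonneg hx₀0))
      (IsSelfAdjoint.zero _) fun v => ?_
    simpa [vectorState_apply] using hcon v
  -- Scaling `ζ` by `n + 1` multiplies its state by `(n + 1) ^ 2`.
  obtain ⟨η, hη⟩ : ∃ η, M.vectorState ξ x₀ < R.vectorState η x₀ := by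
    obtain ⟨n, hn⟩ := exists_nat_gt (M.vectorState ξ x₀ / R.vectorState ζ x₀)
    refine ⟨((n + 1 : ℕ) : ℂ) • ζ, ?_⟩
    have h1 : R.vectorState (((n + 1 : ℕ) : ℂ) • ζ) x₀ = ((n : ℝ) + 1) ^ 2 * R.vectorState ζ x₀ := by
      rw [vectorState_apply, vectorState_apply, map_smul, inner_smul_left, inner_smul_right,
        ← mul_assoc]
      have : (starRingEnd ℂ) ((n + 1 : ℕ) : ℂ) * ((n + 1 : ℕ) : ℂ) = (((n : ℝ) + 1) ^ 2 : ℝ) := by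
        rw [Complex.conj_natCast]; push_cast; ring
      rw [this, Complex.re_ofReal_mul]
    rw [h1]
    rw [div_lt_iff₀ hζ] at hn
    have : (n : ℝ) ≤ ((n : ℝ) + 1) ^ 2 := by nlinarith [(Nat.cast_nonneg n : (0 : ℝ) ≤ n)]
    nlinarith
  -- Remove a maximal `b` on which the wanted inequality is reversed: any violation below `x₀ - b`
  -- could be added to `b`. The strict inequality `hη` ensures `b ≠ x₀`.
  obtain ⟨b, ⟨⟨hb0, hbx, hbφ⟩, hbmax⟩⟩ := exists_maximal_of_chain_closed
    {a : A.toStarSubalgebra | 0 ≤ a ∧ a ≤ x₀ ∧ R.vectorState η a ≤ M.vectorState ξ a}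
    ⟨0, le_rfl, hx₀0, by simp⟩ (fun a ha => ha.1) (fun a ha => ha.2.1) (t := x₀)
    (by
      rintro D hD ⟨d, hd⟩ hdir s hs
      refine ⟨(hD hd).1.trans (hs.1 hd), hs.2 fun a ha => (hD ha).2.1, ?_⟩
      refine (R.isLUB_vectorState η ⟨d, hd⟩ hdir (fun a ha => (hD ha).1) hs).2 ?_
      rintro _ ⟨a, ha, rfl⟩
      exact (hD ha).2.2.trans (M.vectorState_mono ξ (hD ha).1 (hs.1 ha)))
  set x := x₀ - b with hx
  have hx0 : 0 ≤ x := sub_nonneg.2 hbx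
  have hxx₀ : x ≤ x₀ := sub_le_self _ hb0
  have hdom : ∀ c, 0 ≤ c → c ≤ x → M.vectorState ξ c ≤ R.vectorState η c := by
    intro c hc hcx
    by_contra! hcon
    have := hbmax (y := b + c) ⟨add_nonneg hb0 hc, by
      rw [hx, le_sub_iff_add_le'] at hcx; exact hcx, by
        rw [map_add, map_add]; exact add_le_add hbφ hcon.le⟩
      (le_add_of_nonneg_right hc)
    have hc0 : c = 0 := le_antisymm (by simpa using this) hc
    simp [hc0] at hcon
  refine ⟨x, η, fun h0 => ?_, fun a => ?_⟩
  · have h1 : M.vectorState ξ x = 0 := by rw [vectorState_apply, h0]; simp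
    have h2 := hfaith x hx0 hxx₀ h1
    rw [hx, sub_eq_zero] at h2
    rw [← h2] at hbφ
    exact absurd hη (not_lt.2 hbφ)
  · rw [← mul_apply_eq_comp, ← mul_apply_eq_comp, ← map_mul, ← map_mul]
    refine le_of_sq_le_sq ?_ (norm_nonneg _)
    rw [← vectorState_star_mul_self, ← vectorState_star_mul_self]
    -- After division by `N`, the element `(a x)* (a x)` lies below `x`; the `+ 1` keeps `N`
    -- invertible.
    set N := ‖(a : K →L[ℂ] K)‖ ^ 2 * ‖(x : K →L[ℂ] K)‖ + 1 with hN
    have hNpos : 0 < N := by positivity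
    have hle : star (a * x) * (a * x) ≤ N • x := by
      refine (conj_le_smul hx0 a).trans ?_
      rw [hN, add_smul, one_smul]
      exact le_add_of_nonneg_right hx0
    have hnn : 0 ≤ star (a * x) * (a * x) := by
      change (0 : K →L[ℂ] K) ≤ star ((a : K →L[ℂ] K) * x) * ((a : K →L[ℂ] K) * x)
      exact star_mul_self_nonneg _
    have hsmul : ∀ {r : ℝ}, 0 ≤ r → ∀ {c d : A.toStarSubalgebra}, c ≤ d → r • c ≤ r • d :=
      fun {r} hr {c d} hcd => by
        change r • (c : K →L[ℂ] K) ≤ r • (d : K →L[ℂ] K)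
        exact smul_le_smul_of_nonneg_left hcd hr
    have := hdom (N⁻¹ • (star (a * x) * (a * x)))
      (by simpa using hsmul (inv_nonneg.2 hNpos.le) hnn)
      (by simpa [smul_smul, inv_mul_cancel₀ hNpos.ne'] using hsmul (inv_nonneg.2 hNpos.le) hle)
    rw [map_smul, map_smul, smul_eq_mul, smul_eq_mul] at this
    exact le_of_mul_le_mul_left this (inv_pos.2 hNpos)

end Normal

end VonNeumannAlgebra

/-! ### Hilbert dimension under operators with dense range -/

section HilbertDimension

variable {L : Type u} [NormedAddCommGroup L] [InnerProductSpace ℂ L]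
variable {W : Type u} [NormedAddCommGroup W] [InnerProductSpace ℂ W]

theorem DenseRange.exists_inner_ne_zero {T : L →L[ℂ] W} (hT : DenseRange T) {ι : Type u}
    (b : HilbertBasis ι ℂ L) {w : W} (hw : w ≠ 0) : ∃ i, inner ℂ w (T (b i)) ≠ 0 := by
  by_contra! h
  have h1 : ∀ x, (innerSL ℂ w ∘L T) x = 0 := by
    have hle : Submodule.span ℂ (Set.range b) ≤ (innerSL ℂ w ∘L T).ker := by
      rw [Submodule.span_le]
      rintro _ ⟨i, rfl⟩
      exact h i
    have := Submodule.topologicalClosure_minimal _ hle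
      (ContinuousLinearMap.isClosed_ker (innerSL ℂ w ∘L T))
    rw [b.dense_span] at this
    exact fun x => this Submodule.mem_top
  have h2 : (fun y => innerSL ℂ w y) = fun _ => 0 :=
    hT.equalizer (innerSL ℂ w).continuous continuous_const (funext h1)
  exact hw (inner_self_eq_zero.1 (congrFun h2 w))

/-- Hilbert dimension does not increase under a bounded operator with dense range. -/
theorem Orthonormal.mk_le_of_denseRange {T : L →L[ℂ] W} (hT : DenseRange T) {ι : Type u}
    (b : HilbertBasis ι ℂ L) {J : Type u} {v : J → W} (hv : Orthonormal ℂ v) : #J ≤ #ι := by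
  rcases finite_or_infinite ι with hfin | hinf
  -- In finite dimension a dense range is closed, so `T` is onto and algebraic ranks can be
  -- compared.
  · have := Fintype.ofFinite ι
    let b' : Module.Basis ι ℂ L := b.toOrthonormalBasis.toBasis
    have : FiniteDimensional ℂ L := b'.finiteDimensional_of_finite
    have hclosed : IsClosed (Set.range T) :=
      (LinearMap.range (T : L →ₗ[ℂ] W)).closed_of_finiteDimensional
    have hsurj : Function.Surjective (T : L →ₗ[ℂ] W) := fun y => by
      have := hT y
      rwa [hclosed.closure_eq] at this
    calc #J ≤ Module.rank ℂ W := hv.linearIndependent.cardinal_le_rank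
      _ ≤ Module.rank ℂ L := LinearMap.rank_le_of_surjective _ hsurj
      _ = #ι := b'.mk_eq_rank''.symm
  -- By Bessel's inequality each `T (b i)` meets only countably many `v j`, and by density every `v
  -- j` is met.
  · have hcount : ∀ i, Set.Countable {j | inner ℂ (v j) (T (b i)) ≠ 0} := by
      intro i
      have := (hv.inner_products_summable (x := T (b i))).countable_support
      refine this.mono fun j hj => ?_
      simpa using hj
    have hcover : (⋃ i, {j | inner ℂ (v j) (T (b i)) ≠ 0}) = Set.univ := by
      rw [Set.eq_univ_iff_forall]
      intro j
      obtain ⟨i, hi⟩ := hT.exists_inner_ne_zero b (hv.ne_zero j)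
      exact Set.mem_iUnion.2 ⟨i, hi⟩
    calc #J = #(⋃ i, {j | inner ℂ (v j) (T (b i)) ≠ 0}) := by rw [hcover, Cardinal.mk_univ]
      _ ≤ Cardinal.sum fun i => #{j | inner ℂ (v j) (T (b i)) ≠ 0} :=
        Cardinal.mk_iUnion_le_sum_mk
      _ ≤ Cardinal.sum fun _ : ι => ℵ₀ := Cardinal.sum_le_sum _ _ fun i => (hcount i).le_aleph0
      _ = #ι * ℵ₀ := by simp
      _ = #ι := Cardinal.mul_aleph0_eq (Cardinal.aleph0_le_mk ι)

theorem Orthonormal.mk_le_of_hilbertBasis {ι : Type u} (b : HilbertBasis ι ℂ L) {J : Type u}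
    {v : J → L} (hv : Orthonormal ℂ v) : #J ≤ #ι :=
  hv.mk_le_of_denseRange (T := ContinuousLinearMap.id ℂ L) Function.surjective_id.denseRange b

/-- The assignment `f a ↦ g a` is well defined and contractive, so it extends to the closure of the
range of `f`; composing with the orthogonal projection gives an operator on all of `L`. -/
theorem exists_hilbertBasis_mk_le_of_norm_le [CompleteSpace L] [CompleteSpace W]
    {E : Type*} [AddCommGroup E] [Module ℂ E] (f : E →ₗ[ℂ] L) (g : E →ₗ[ℂ] W)
    (hg : DenseRange g) (hfg : ∀ a, ‖g a‖ ≤ ‖f a‖) {ι : Type u} (b : HilbertBasis ι ℂ L) :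
    ∃ ι' : Type u, #ι' ≤ #ι ∧ Nonempty (HilbertBasis ι' ℂ W) := by
  obtain ⟨w, b', hb'⟩ := exists_hilbertBasis ℂ W
  refine ⟨w, ?_, ⟨b'⟩⟩
  let V := (LinearMap.range f).topologicalClosure
  have : CompleteSpace V := (LinearMap.range f).isClosed_topologicalClosure.completeSpace_coe
  let e : E →ₗ[ℂ] V := f.codRestrict V fun a =>
    (LinearMap.range f).le_topologicalClosure ⟨a, rfl⟩
  have he : DenseRange e := by
    rintro ⟨y, hy⟩
    rw [closure_subtype]
    have : ((↑) : V → L) '' Set.range e = (LinearMap.range f : Set L) := by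
      rw [← Set.range_comp]; rfl
    rw [this]
    exact hy
  have hbound : ∃ C, ∀ a, ‖g a‖ ≤ C * ‖e a‖ := ⟨1, fun a => by rw [one_mul]; exact hfg a⟩
  let T : L →L[ℂ] W := (g.extendOfNorm e) ∘L V.orthogonalProjectionOnto
  have hT : DenseRange T := by
    refine hg.mono ?_
    rintro _ ⟨a, rfl⟩
    refine ⟨e a, ?_⟩
    change g.extendOfNorm e (V.orthogonalProjectionOnto (e a : L)) = g a
    rw [Submodule.orthogonalProjectionOnto_mem_subspace_eq_self, LinearMap.extendOfNorm_eq he hbound]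
  exact b'.orthonormal.mk_le_of_denseRange hT b

theorem OrthogonalFamily.exists_hilbertBasis_sigma [CompleteSpace L] {J : Type*}
    {F : J → Submodule ℂ L} (hF : OrthogonalFamily ℂ (fun j => F j) fun j => (F j).subtypeₗᵢ)
    (htop : (⨆ j, F j)ᗮ = ⊥) {ι : J → Type*} (b : ∀ j, HilbertBasis (ι j) ℂ (F j)) :
    Nonempty (HilbertBasis (Σ j, ι j) ℂ L) := by
  refine ⟨HilbertBasis.mkOfOrthogonalEqBot
    (hF.orthonormal_sigma_orthonormal fun j => (b j).orthonormal) ?_⟩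
  rw [eq_bot_iff, ← htop]
  refine fun x hx => (Submodule.mem_orthogonal' _ _).2 fun y hy => ?_
  have hle : ∀ j, F j ≤ (innerSL ℂ x).ker := by
    intro j z hz
    have h1 : Submodule.span ℂ (Set.range (b j)) ≤ ((innerSL ℂ x) ∘L (F j).subtypeL).ker := by
      rw [Submodule.span_le]
      rintro _ ⟨i, rfl⟩
      exact (Submodule.mem_orthogonal' _ _).1 hx _ (Submodule.subset_span ⟨⟨j, i⟩, rfl⟩)
    have h2 := Submodule.topologicalClosure_minimal _ h1
      (ContinuousLinearMap.isClosed_ker ((innerSL ℂ x) ∘L (F j).subtypeL))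
    rw [(b j).dense_span] at h2
    exact h2 (Submodule.mem_top (x := (⟨z, hz⟩ : F j)))
  exact iSup_le hle hy

end HilbertDimension

/-! ### Cyclic decompositions and small modules -/

namespace VonNeumannAlgebra

variable {K : Type u} [NormedAddCommGroup K] [InnerProductSpace ℂ K] [CompleteSpace K]
variable {H : Type u} [NormedAddCommGroup H] [InnerProductSpace ℂ H] [CompleteSpace H]
variable {L : Type u} [NormedAddCommGroup L] [InnerProductSpace ℂ L] [CompleteSpace L]
variable {A : VonNeumannAlgebra K}

/-- Pairwise orthogonal nonzero projections in a `κ`-separable von Neumann algebra form a family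
of cardinality `< κ`. -/
theorem IsKappaSeparable.mk_lt {κ : Cardinal.{u}} (hA : A.IsKappaSeparable κ) {J : Type u}
    (p : J → A.toStarSubalgebra) (hp : ∀ j, IsStarProjection (p j)) (hne : ∀ j, p j ≠ 0)
    (horth : Pairwise fun i j => p i * p j = 0) : #J < κ := by
  obtain ⟨L, _, _, _, M, hM, ι, hι, ⟨b⟩⟩ := hA
  refine lt_of_le_of_lt ?_ hι
  -- Unit vectors in the ranges of orthogonal projections form an orthonormal family.
  have hex : ∀ j, ∃ v, M.action (p j) v = v ∧ ‖v‖ = 1 := by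
    intro j
    have h0 : M.action (p j) ≠ 0 := fun h => hne j (hM (by rw [h, map_zero]))
    obtain ⟨v, hv⟩ : ∃ v, M.action (p j) v ≠ 0 := by
      by_contra! h
      exact h0 (ContinuousLinearMap.ext h)
    refine ⟨((‖M.action (p j) v‖⁻¹ : ℝ) : ℂ) • M.action (p j) v, ?_, ?_⟩
    · rw [map_smul, ← mul_apply_eq_comp, ← map_mul, (hp j).isIdempotentElem.eq]
    · rw [norm_smul, Complex.norm_real, norm_inv, norm_norm, inv_mul_cancel₀ (norm_ne_zero_iff.2 hv)]
  choose v hv hv1 using hex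
  refine Orthonormal.mk_le_of_hilbertBasis b (v := v) ⟨hv1, fun i j hij => ?_⟩
  change inner ℂ (v i) (v j) = 0
  rw [← hv i, ← hv j, ← ContinuousLinearMap.adjoint_inner_right,
    ← ContinuousLinearMap.star_eq_adjoint, ← map_star, (hp i).isSelfAdjoint.star_eq,
    ← mul_apply_eq_comp, ← map_mul, horth hij]
  simp

namespace NormalModule

variable (M : NormalModule H A)

/-- The map `a ↦ a v`. -/
noncomputable def orbitMap (v : H) : A.toStarSubalgebra →ₗ[ℂ] H where
  toFun a := M.action a v
  map_add' a b := by simp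
  map_smul' c a := by simp

/-- The closed submodule generated by a vector. -/
noncomputable def cyclic (v : H) : Submodule ℂ H :=
  (LinearMap.range (M.orbitMap v)).topologicalClosure

theorem isClosed_cyclic (v : H) : IsClosed (M.cyclic v : Set H) :=
  Submodule.isClosed_topologicalClosure _

instance (v : H) : CompleteSpace (M.cyclic v) := (M.isClosed_cyclic v).completeSpace_coe

theorem action_mem_cyclic (a : A.toStarSubalgebra) (v : H) : M.action a v ∈ M.cyclic v :=
  Submodule.le_topologicalClosure _ ⟨a, rfl⟩

theorem mem_cyclic_self (v : H) : v ∈ M.cyclic v := by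
  simpa using M.action_mem_cyclic 1 v

theorem cyclic_le {U : Submodule ℂ H} (hU : IsClosed (U : Set H)) {v : H}
    (h : ∀ a, M.action a v ∈ U) : M.cyclic v ≤ U := by
  refine Submodule.topologicalClosure_minimal _ ?_ hU
  rintro _ ⟨a, rfl⟩
  exact h a

theorem action_mem_cyclic_of_mem (a : A.toStarSubalgebra) {v w : H} (hw : w ∈ M.cyclic v) :
    M.action a w ∈ M.cyclic v := by
  have h : M.cyclic v ≤ (M.cyclic v).comap (M.action a : H →ₗ[ℂ] H) := by
    refine M.cyclic_le ((M.isClosed_cyclic v).preimage (M.action a).continuous) fun c => ?_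
    change M.action a (M.action c v) ∈ M.cyclic v
    rw [← mul_apply_eq_comp, ← map_mul]
    exact M.action_mem_cyclic _ v
  exact h hw

theorem inner_action_left (a : A.toStarSubalgebra) (v w : H) :
    inner ℂ (M.action a v) w = inner ℂ v (M.action (star a) w) := by
  rw [map_star, ContinuousLinearMap.star_eq_adjoint, ContinuousLinearMap.adjoint_inner_right]

/-- The algebra is closed under adjoints, which move the action across the inner product. -/
theorem action_mem_orthogonal {U : Submodule ℂ H} (hU : ∀ a, ∀ v ∈ U, M.action a v ∈ U)
    (a : A.toStarSubalgebra) {w : H} (hw : w ∈ Uᗮ) : M.action a w ∈ Uᗮ := by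
  rw [Submodule.mem_orthogonal'] at hw ⊢
  intro v hv
  rw [inner_action_left]
  exact hw _ (hU _ v hv)

theorem starProjection_mem_endAlgebra (U : Submodule ℂ H) [U.HasOrthogonalProjection]
    (hU : ∀ a, ∀ v ∈ U, M.action a v ∈ U) : U.starProjection ∈ M.endAlgebra := by
  rw [mem_endAlgebra_iff]
  intro a v
  refine Submodule.eq_starProjection_of_mem_orthogonal (hU a _ (U.starProjection_apply_mem v)) ?_
  rw [← map_sub]
  exact M.action_mem_orthogonal hU a (U.sub_starProjection_mem_orthogonal v)

theorem cyclic_le_orthogonal {U : Submodule ℂ H} (hU : ∀ a, ∀ v ∈ U, M.action a v ∈ U) {w : H}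
    (hw : w ∈ Uᗮ) : M.cyclic w ≤ Uᗮ :=
  M.cyclic_le U.isClosed_orthogonal fun a => M.action_mem_orthogonal hU a hw

/-- If every nonzero closed submodule contains a nonzero vector satisfying `P`, then the module
is a Hilbert sum of cyclic submodules generated by nonzero vectors satisfying `P`. -/
theorem exists_cyclic_decomposition (P : H → Prop)
    (hP : ∀ v ≠ 0, ∃ a, M.action a v ≠ 0 ∧ P (M.action a v)) :
    ∃ J : Set H, (∀ v ∈ J, v ≠ 0 ∧ P v) ∧
      (Pairwise fun v w : J => M.cyclic v ≤ (M.cyclic w)ᗮ) ∧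
      (⨆ v : J, M.cyclic v)ᗮ = ⊥ := by
  obtain ⟨J, hJ⟩ := zorn_subset
    {J : Set H | (∀ v ∈ J, v ≠ 0 ∧ P v) ∧ J.Pairwise fun v w => M.cyclic v ≤ (M.cyclic w)ᗮ}
    (fun c hc hchain => ⟨⋃₀ c, ⟨by
      rintro v ⟨S, hS, hv⟩
      exact (hc hS).1 v hv,
      (Set.pairwise_sUnion hchain.directedOn).2 fun S hS => (hc hS).2⟩,
      fun S hS => Set.subset_sUnion_of_mem hS⟩)
  refine ⟨J, hJ.prop.1, fun v w hvw => hJ.prop.2 v.2 w.2 (fun h => hvw (Subtype.ext h)), ?_⟩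
  have hinv : ∀ a, ∀ v ∈ ⨆ v : J, M.cyclic v, M.action a v ∈ ⨆ v : J, M.cyclic v := by
    intro a
    have : (⨆ v : J, M.cyclic v) ≤
        (⨆ v : J, M.cyclic v).comap (M.action a : H →ₗ[ℂ] H) :=
      iSup_le fun v w hw => (le_iSup (fun v : J => M.cyclic v) v)
        (M.action_mem_cyclic_of_mem a hw)
    exact this
  rw [Submodule.eq_bot_iff]
  intro ξ hξ
  by_contra hne
  obtain ⟨a, ha0, haP⟩ := hP ξ hne
  have hmem := M.action_mem_orthogonal hinv a hξ
  set ζ := M.action a ξ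
  have hcyc := M.cyclic_le_orthogonal hinv hmem
  have horth : ∀ v ∈ J, M.cyclic ζ ≤ (M.cyclic v)ᗮ := fun v hv =>
    hcyc.trans (Submodule.orthogonal_le (le_iSup (fun v : J => M.cyclic v) ⟨v, hv⟩))
  -- Maximality puts `ζ` in `J`, so its cyclic submodule is orthogonal to itself, although `ζ ≠ 0`.
  have hζJ : ζ ∈ J := by
    refine hJ.le_of_ge (y := insert ζ J) ⟨?_, ?_⟩ (Set.subset_insert _ _) (Set.mem_insert _ _)
    · rintro v (rfl | hv)
      exacts [⟨ha0, haP⟩, hJ.prop.1 v hv]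
    · refine hJ.prop.2.insert fun v hv _ => ⟨horth v hv, ?_⟩
      rw [← Submodule.orthogonal_orthogonal (M.cyclic v)]
      exact Submodule.orthogonal_le (horth v hv)
  have h1 := horth ζ hζJ (M.mem_cyclic_self ζ)
  exact ha0 (inner_self_eq_zero.1 ((Submodule.mem_orthogonal _ _).1 h1 ζ (M.mem_cyclic_self ζ)))

/-- A `κ`-small module is a Hilbert sum of fewer than `κ` cyclic submodules, whose dimensions can
be taken from any class of cardinals that is rich enough. -/
theorem IsKappaSmall.exists_hilbertBasis {κ : Cardinal.{u}} {M : NormalModule H A}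
    (hM : M.IsKappaSmall κ) (P : Cardinal.{u} → Prop)
    (hP : ∀ v ≠ 0, ∃ a, M.action a v ≠ 0 ∧
      ∃ ι : Type u, P #ι ∧ Nonempty (HilbertBasis ι ℂ (M.cyclic (M.action a v)))) :
    ∃ (J : Type u) (ι : J → Type u), #J < κ ∧ (∀ j, P #(ι j)) ∧
      Nonempty (HilbertBasis (Σ j, ι j) ℂ H) := by
  obtain ⟨J, hJ, horth, htop⟩ := M.exists_cyclic_decomposition
    (fun w => ∃ ι : Type u, P #ι ∧ Nonempty (HilbertBasis ι ℂ (M.cyclic w))) hP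
  choose ι hι b using fun j : J => (hJ j j.2).2
  refine ⟨J, ι, ?_, hι, ?_⟩
  · refine IsKappaSeparable.mk_lt hM
      (fun j : J => ⟨(M.cyclic j).starProjection, M.starProjection_mem_endAlgebra _
        fun a v hv => M.action_mem_cyclic_of_mem a hv⟩) (fun j => ?_) (fun j h => ?_)
      fun i j hij => ?_
    · have := isStarProjection_starProjection (U := M.cyclic (j : H))
      exact ⟨Subtype.ext this.isIdempotentElem, Subtype.ext this.isSelfAdjoint⟩
    · have h1 : (M.cyclic (j : H)).starProjection = 0 := congrArg Subtype.val h
      have h2 := Submodule.starProjection_eq_self_iff.2 (M.mem_cyclic_self (j : H))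
      rw [h1] at h2
      exact (hJ j j.2).1 h2.symm
    · refine Subtype.ext (ContinuousLinearMap.ext fun v => ?_)
      change (M.cyclic (i : H)).starProjection ((M.cyclic (j : H)).starProjection v) = 0
      rw [Submodule.starProjection_apply_eq_zero_iff]
      exact horth hij.symm (Submodule.starProjection_apply_mem _ v)
  · refine OrthogonalFamily.exists_hilbertBasis_sigma (F := fun j : J => M.cyclic j) ?_ htop
      fun j => (b j).some
    exact fun i j hij v w => (Submodule.mem_orthogonal' _ _).1 (horth hij v.2) _ w.2

/-- A cyclic submodule dominated by a cyclic submodule of `R` has at most the dimension of `R`. -/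
theorem exists_hilbertBasis_cyclic (R : NormalModule L A) {ξ : H} {η : L}
    (h : ∀ a, ‖M.action a ξ‖ ≤ ‖R.action a η‖) {ι : Type u} (b : HilbertBasis ι ℂ L) :
    ∃ ι' : Type u, #ι' ≤ #ι ∧ Nonempty (HilbertBasis ι' ℂ (M.cyclic ξ)) := by
  refine exists_hilbertBasis_mk_le_of_norm_le (R.orbitMap η)
    ((M.orbitMap ξ).codRestrict (M.cyclic ξ) fun a => M.action_mem_cyclic a ξ) ?_ h b
  rintro ⟨y, hy⟩
  rw [closure_subtype]
  have : ((↑) : M.cyclic ξ → H) '' Set.range ((M.orbitMap ξ).codRestrict (M.cyclic ξ)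
      fun a => M.action_mem_cyclic a ξ) = (LinearMap.range (M.orbitMap ξ) : Set H) := by
    rw [← Set.range_comp]; rfl
  rw [this]
  exact hy

/-- The element `p` allows `R` to be faithful only on a corner: `p = 1` serves a single algebra, a
central projection serves a product. -/
theorem exists_hilbertBasis_cyclic_action (R : NormalModule L A)
    {p : A.toStarSubalgebra} (hp : 0 ≤ p)
    (hR : ∀ a, 0 ≤ a → a ≤ p → R.action a = 0 → a = 0) {ξ : H} (hξ : M.vectorState ξ p ≠ 0)
    {ι : Type u} (b : HilbertBasis ι ℂ L) :
    ∃ a, M.action a ξ ≠ 0 ∧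
      ∃ ι' : Type u, #ι' ≤ #ι ∧ Nonempty (HilbertBasis ι' ℂ (M.cyclic (M.action a ξ))) := by
  obtain ⟨x, η, hx, h⟩ := M.exists_norm_action_le R hp hR hξ
  exact ⟨x, hx, M.exists_hilbertBasis_cyclic R h b⟩

theorem IsKappaSmall.isKappaSeparableHilbert {κ : Cardinal.{u}} (hκ : ℵ₀ ≤ κ)
    (hA : A.IsKappaSeparable κ) {M : NormalModule H A} (hM : M.IsKappaSmall κ) :
    IsKappaSeparableHilbert κ H := by
  obtain ⟨L, _, _, _, R, hR, ι, hι, ⟨b⟩⟩ := hA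
  obtain ⟨J, ι', hJ, hι', hb⟩ := hM.exists_hilbertBasis (· ≤ #ι) fun v hv =>
    M.exists_hilbertBasis_cyclic_action R (p := 1)
      (by change (0 : K →L[ℂ] K) ≤ 1; exact zero_le_one)
      (fun a _ _ h => hR (by rw [h, map_zero]))
      (by
        rw [vectorState_apply, map_one]
        exact fun h => hv (by
          have h' : RCLike.re (inner ℂ v v) = 0 := h
          rwa [inner_self_eq_norm_sq, sq_eq_zero_iff, norm_eq_zero] at h')) b
  refine ⟨_, ?_, hb⟩
  rw [Cardinal.mk_sigma]
  calc _ ≤ Cardinal.sum fun _ : J => #ι := Cardinal.sum_le_sum _ _ hι'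
    _ = #J * #ι := by simp
    _ < κ := Cardinal.mul_lt_of_lt hκ hJ hι

end NormalModule

end VonNeumannAlgebra

/-! ### Products of von Neumann algebras -/

namespace VonNeumannAlgebra

section Product

variable {I : Type u} {K : I → Type u} [∀ i, NormedAddCommGroup (K i)]
  [∀ i, InnerProductSpace ℂ (K i)]

open Classical in
theorem summandInclusion_apply_self (i : I) (v : K i) : summandInclusion (K := K) i v i = v :=
  lp.single_apply_self 2 i v

open Classical in
theorem summandInclusion_apply_of_ne {i j : I} (h : j ≠ i) (v : K i) :
    summandInclusion (K := K) i v j = 0 :=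
  lp.single_apply_ne 2 i v h

variable [∀ i, CompleteSpace (K i)]

open Classical in
theorem adjoint_summandInclusion_apply (i : I) (x : lp K 2) :
    ContinuousLinearMap.adjoint (summandInclusion (K := K) i) x = x i := by
  refine ext_inner_left ℂ fun v => ?_
  rw [ContinuousLinearMap.adjoint_inner_right]
  exact lp.inner_single_left i v x

theorem blockOperator_eq (i : I) (a : K i →L[ℂ] K i) (x : lp K 2) :
    blockOperator i a x = summandInclusion i (a (x i)) := by
  rw [← adjoint_summandInclusion_apply]
  rfl

theorem blockOperator_mul (i : I) (a b : K i →L[ℂ] K i) :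
    blockOperator (K := K) i (a * b) = blockOperator i a * blockOperator i b := by
  ext1 x
  rw [mul_apply_eq_comp, blockOperator_eq, blockOperator_eq, blockOperator_eq,
    summandInclusion_apply_self]
  rfl

theorem blockOperator_mul_of_ne {i j : I} (h : i ≠ j) (a : K i →L[ℂ] K i) (b : K j →L[ℂ] K j) :
    blockOperator (K := K) i a * blockOperator j b = 0 := by
  ext1 x
  rw [mul_apply_eq_comp, blockOperator_eq, blockOperator_eq, summandInclusion_apply_of_ne h]
  simp

theorem star_blockOperator (i : I) (a : K i →L[ℂ] K i) :
    star (blockOperator (K := K) i a) = blockOperator i (star a) := by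
  simp only [blockOperator, ContinuousLinearMap.star_eq_adjoint, ContinuousLinearMap.adjoint_comp,
    ContinuousLinearMap.adjoint_adjoint, ContinuousLinearMap.comp_assoc]

theorem isStarProjection_blockOperator_one (i : I) :
    IsStarProjection (blockOperator (K := K) i 1) := by
  refine ⟨?_, ?_⟩
  · rw [IsIdempotentElem, ← blockOperator_mul, mul_one]
  · rw [IsSelfAdjoint, star_blockOperator, star_one]

theorem inner_blockOperator (i : I) (a : K i →L[ℂ] K i) (x y : lp K 2) :
    inner ℂ (blockOperator i a x) y = inner ℂ (a (x i)) (y i) := by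
  rw [blockOperator_eq, ← ContinuousLinearMap.adjoint_inner_right, adjoint_summandInclusion_apply]

variable (A : ∀ i, VonNeumannAlgebra (K i))

theorem blockOperator_mem_product {i : I} {a : K i →L[ℂ] K i} (ha : a ∈ A i) :
    blockOperator i a ∈ product A := by
  change _ ∈ StarSubalgebra.centralizer ℂ _
  rw [StarSubalgebra.mem_centralizer_iff]
  intro g hg
  have hg' : ∀ g ∈ commutantOf (⋃ i, blockOperator (K := K) i '' (A i : Set (K i →L[ℂ] K i))),
      g * blockOperator i a = blockOperator i a * g := by
    intro g hg
    exact (((StarSubalgebra.mem_centralizer_iff ℂ).1 hg) _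
      (Set.mem_iUnion.2 ⟨i, a, ha, rfl⟩)).1.symm
  exact ⟨hg' g hg, hg' _ (star_mem hg)⟩

/-- The block of `b` commutes with every generator, since blocks on different summands annihilate
each other. With `b = 1` this says that the product preserves each summand. -/
theorem blockOperator_comm_of_mem_commutant {i : I} {b : K i →L[ℂ] K i} (hb : b ∈ (A i).commutant)
    {a : lp K 2 →L[ℂ] lp K 2} (ha : a ∈ product A) :
    blockOperator i b * a = a * blockOperator i b := by
  refine (((StarSubalgebra.mem_centralizer_iff ℂ).1 ha) (blockOperator i b) ?_).1
  have hcomm : ∀ j, ∀ c ∈ A j,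
      blockOperator (K := K) j c * blockOperator i b = blockOperator i b * blockOperator j c := by
    intro j c hc
    by_cases hij : j = i
    · subst hij
      rw [← blockOperator_mul, ← blockOperator_mul, mem_commutant_iff.1 hb c hc]
    · rw [blockOperator_mul_of_ne hij, blockOperator_mul_of_ne (Ne.symm hij)]
  refine (StarSubalgebra.mem_centralizer_iff ℂ).2 ?_
  rintro _ hg
  obtain ⟨j, c, hc, rfl⟩ := Set.mem_iUnion.1 hg
  refine ⟨hcomm j c hc, ?_⟩
  rw [star_blockOperator]
  exact hcomm j _ (star_mem hc)

/-- The compression of an operator on `⨁ K i` to the `i`-th summand. -/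
noncomputable def compression (i : I) (a : lp K 2 →L[ℂ] lp K 2) : K i →L[ℂ] K i :=
  ContinuousLinearMap.adjoint (summandInclusion i) ∘L a ∘L summandInclusion i

theorem compression_apply (i : I) (a : lp K 2 →L[ℂ] lp K 2) (v : K i) :
    compression i a v = a (summandInclusion i v) i := by
  rw [← adjoint_summandInclusion_apply]
  rfl

theorem inner_compression (i : I) (a : lp K 2 →L[ℂ] lp K 2) (v w : K i) :
    inner ℂ (compression i a v) w = inner ℂ (a (summandInclusion i v)) (summandInclusion i w) := by
  rw [compression, ContinuousLinearMap.comp_apply, ContinuousLinearMap.adjoint_inner_left]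
  rfl

theorem blockOperator_apply_summandInclusion (i : I) (b : K i →L[ℂ] K i) (v : K i) :
    blockOperator (K := K) i b (summandInclusion i v) = summandInclusion i (b v) := by
  rw [blockOperator_eq, summandInclusion_apply_self]

theorem star_compression (i : I) (a : lp K 2 →L[ℂ] lp K 2) :
    compression i (star a) = star (compression i a) := by
  simp only [compression, ContinuousLinearMap.star_eq_adjoint, ContinuousLinearMap.adjoint_comp,
    ContinuousLinearMap.adjoint_adjoint, ContinuousLinearMap.comp_assoc]

theorem compression_algebraMap (i : I) (c : ℂ) :
    compression i (algebraMap ℂ (lp K 2 →L[ℂ] lp K 2) c) = algebraMap ℂ (K i →L[ℂ] K i) c := by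
  ext v
  rw [compression_apply, Algebra.algebraMap_eq_smul_one, Algebra.algebraMap_eq_smul_one,
    smul_apply, smul_apply, one_apply_eq_self, one_apply_eq_self, lp.coeFn_smul, Pi.smul_apply,
    summandInclusion_apply_self]

variable {A}

theorem apply_summandInclusion {a : lp K 2 →L[ℂ] lp K 2} (ha : a ∈ product A) (i : I) (v : K i) :
    a (summandInclusion i v) = summandInclusion i (compression i a v) := by
  have h := congrArg (fun S : lp K 2 →L[ℂ] lp K 2 => S (summandInclusion i v))
    (blockOperator_comm_of_mem_commutant A (i := i) (one_mem (A i).commutant) ha)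
  simp only [mul_apply_eq_comp, blockOperator_apply_summandInclusion] at h
  rw [blockOperator_eq] at h
  rw [compression_apply]
  exact h.symm

theorem compression_mem {a : lp K 2 →L[ℂ] lp K 2} (ha : a ∈ product A) (i : I) :
    compression i a ∈ A i := by
  rw [← commutant_commutant (A i), mem_commutant_iff]
  intro b hb
  ext v
  have h := congrArg (fun S : lp K 2 →L[ℂ] lp K 2 => S (summandInclusion i v) i)
    (blockOperator_comm_of_mem_commutant A hb ha)
  simp only [mul_apply_eq_comp, blockOperator_apply_summandInclusion] at h
  rw [blockOperator_eq, summandInclusion_apply_self, ← compression_apply, ← compression_apply] at h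
  exact h

variable (A) in
/-- The projection of a product of von Neumann algebras onto a factor. -/
noncomputable def productProj (i : I) :
    (product A).toStarSubalgebra →⋆ₐ[ℂ] (A i).toStarSubalgebra where
  toFun a := ⟨compression i a, compression_mem a.2 i⟩
  map_one' := Subtype.ext <| by
    ext v
    exact (compression_apply i 1 v).trans (summandInclusion_apply_self i v)
  map_mul' a b := Subtype.ext <| by
    ext v
    change compression i ((a : lp K 2 →L[ℂ] lp K 2) * (b : lp K 2 →L[ℂ] lp K 2)) v = compression i a (compression i b v)
    -- Compression is multiplicative here because `b` preserves the summand.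
    rw [compression_apply, mul_apply_eq_comp, apply_summandInclusion b.2, ← compression_apply]
  map_zero' := Subtype.ext <| by
    ext v
    exact compression_apply i 0 v
  map_add' a b := Subtype.ext <| by
    ext v
    change compression i ((a : lp K 2 →L[ℂ] lp K 2) + (b : lp K 2 →L[ℂ] lp K 2)) v = compression i a v + compression i b v
    simp only [compression_apply]
    rfl
  commutes' c := Subtype.ext (compression_algebraMap i c)
  map_star' a := Subtype.ext (star_compression i (a : lp K 2 →L[ℂ] lp K 2))

theorem coe_productProj (i : I) (a : (product A).toStarSubalgebra) :
    (productProj A i a : K i →L[ℂ] K i) = compression i a := rfl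

theorem productProj_nonneg (i : I) {a : (product A).toStarSubalgebra} (ha : 0 ≤ a) :
    0 ≤ productProj A i a := by
  change (0 : K i →L[ℂ] K i) ≤ compression i a
  rw [ContinuousLinearMap.nonneg_iff_isPositive]
  exact ((ContinuousLinearMap.nonneg_iff_isPositive _).1
    (show (0 : lp K 2 →L[ℂ] lp K 2) ≤ a from ha)).adjoint_conj (summandInclusion i)

theorem productProj_mono (i : I) {a b : (product A).toStarSubalgebra} (hab : a ≤ b) :
    productProj A i a ≤ productProj A i b := by
  rw [← sub_nonneg, ← map_sub]
  exact productProj_nonneg i (sub_nonneg.2 hab)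

/-- Suprema are detected by quadratic forms, and the form of a compression is the original form
restricted to the summand. This makes pullbacks normal. -/
theorem isLUB_productProj (i : I) {D : Set (product A).toStarSubalgebra} (hne : D.Nonempty)
    (hdir : DirectedOn (· ≤ ·) D) (hpos : ∀ a ∈ D, 0 ≤ a) {s : (product A).toStarSubalgebra}
    (hs : IsLUB D s) : IsLUB (productProj A i '' D) (productProj A i s) := by
  obtain ⟨d, hd⟩ := hne
  have hs0 : 0 ≤ s := (hpos d hd).trans (hs.1 hd)
  have h : IsLUB ((fun a => (productProj A i a : K i →L[ℂ] K i)) '' D)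
      (productProj A i s : K i →L[ℂ] K i) := by
    refine ContinuousLinearMap.isLUB_of_isLUB_re_inner (Set.Nonempty.image _ ⟨d, hd⟩) ?_
      (IsSelfAdjoint.of_nonneg (productProj_nonneg i hs0)) fun v => ?_
    · rintro _ ⟨a, ha, rfl⟩
      exact productProj_nonneg i (hpos a ha)
    · rw [Set.image_image]
      simp only [coe_productProj, inner_compression]
      exact isLUB_re_inner ⟨d, hd⟩ hdir hpos hs (summandInclusion i v)
  refine ⟨?_, fun b hb => h.2 ?_⟩
  · rintro _ ⟨a, ha, rfl⟩
    exact h.1 ⟨a, ha, rfl⟩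
  · rintro _ ⟨a, ha, rfl⟩
    exact hb ⟨a, ha, rfl⟩

variable {L : Type u} [NormedAddCommGroup L] [InnerProductSpace ℂ L] [CompleteSpace L]

/-- The pullback of a module over a factor to the product. -/
noncomputable def NormalModule.pullback {i : I} (R : NormalModule L (A i)) :
    NormalModule L (product A) where
  action := R.action.comp (productProj A i)
  isNormal D hne hdir hpos s hs := by
    have := R.isNormal (productProj A i '' D) (hne.image _)
      (by
        rintro _ ⟨a, ha, rfl⟩ _ ⟨b, hb, rfl⟩
        obtain ⟨c, hc, hac, hbc⟩ := hdir a ha b hb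
        exact ⟨_, ⟨c, hc, rfl⟩, productProj_mono i hac, productProj_mono i hbc⟩)
      (by rintro _ ⟨a, ha, rfl⟩; exact productProj_nonneg i (hpos a ha)) _
      (isLUB_productProj i hne hdir hpos hs)
    rwa [Set.image_image] at this

variable (A) in
/-- The central projection of a product of von Neumann algebras onto the `i`-th summand. -/
noncomputable def centralProjection (i : I) : (product A).toStarSubalgebra :=
  ⟨blockOperator i 1, blockOperator_mem_product A (one_mem (A i))⟩

theorem centralProjection_nonneg (i : I) : 0 ≤ centralProjection A i := by
  change (0 : lp K 2 →L[ℂ] lp K 2) ≤ blockOperator i 1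
  exact (isStarProjection_blockOperator_one (K := K) i).nonneg

/-- The upper bound forces `a` to vanish off the `i`-th summand, and on that summand `a` is its own
compression. -/
theorem eq_zero_of_le_centralProjection {i : I} {a : (product A).toStarSubalgebra} (ha : 0 ≤ a)
    (hai : a ≤ centralProjection A i) (h : productProj A i a = 0) : a = 0 := by
  have h0 : compression i (a : lp K 2 →L[ℂ] lp K 2) = 0 := congrArg Subtype.val h
  have hcomm := blockOperator_comm_of_mem_commutant A (i := i) (one_mem (A i).commutant) a.2
  refine Subtype.ext (ContinuousLinearMap.ext fun x => ?_)
  have hz : (a : lp K 2 →L[ℂ] lp K 2) (blockOperator i 1 x) = 0 := by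
    rw [blockOperator_eq, apply_summandInclusion a.2, h0]
    simp
  set y := x - blockOperator (K := K) i 1 x with hy
  have hy0 : blockOperator (K := K) i 1 y = 0 := by
    rw [hy, map_sub, sub_eq_zero, ← mul_apply_eq_comp,
      (isStarProjection_blockOperator_one (K := K) i).isIdempotentElem.eq]
  have h1 := ContinuousLinearMap.re_inner_mono
    (show (a : lp K 2 →L[ℂ] lp K 2) ≤ blockOperator i 1 from hai) y
  rw [hy0, inner_zero_left, Complex.zero_re] at h1
  have h2 := ContinuousLinearMap.norm_apply_sq_le_of_nonneg
    (show (0 : lp K 2 →L[ℂ] lp K 2) ≤ a from ha) y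
  have h3 : ‖(a : lp K 2 →L[ℂ] lp K 2) y‖ ^ 2 ≤ 0 :=
    h2.trans (mul_nonpos_of_nonneg_of_nonpos (norm_nonneg _) h1)
  have h4 : (a : lp K 2 →L[ℂ] lp K 2) y = 0 := by
    rw [← norm_eq_zero, ← sq_eq_zero_iff]
    exact le_antisymm h3 (sq_nonneg _)
  have h5 : x = y + blockOperator i 1 x := by rw [hy, sub_add_cancel]
  rw [h5, map_add, h4, hz, add_zero]
  rfl

/-- On quadratic forms this is `‖v‖² = ∑ ‖v i‖²`. -/
theorem isLUB_sum_centralProjection :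
    IsLUB (Set.range fun F : Finset I => ∑ i ∈ F, centralProjection A i) 1 := by
  have hval : ∀ (F : Finset I), ((∑ i ∈ F, centralProjection A i : (product A).toStarSubalgebra) :
      lp K 2 →L[ℂ] lp K 2) = ∑ i ∈ F, blockOperator i 1 := fun F => by
    rw [AddSubmonoidClass.coe_finsetSum]
    rfl
  have key : IsLUB (Set.range fun F : Finset I => ∑ i ∈ F, blockOperator (K := K) i 1) 1 := by
    refine ContinuousLinearMap.isLUB_of_isLUB_re_inner (Set.range_nonempty _) ?_ (IsSelfAdjoint.one _)
      fun v => ?_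
    · rintro _ ⟨F, rfl⟩
      exact Finset.sum_nonneg fun i _ => (isStarProjection_blockOperator_one (K := K) i).nonneg
    · have hsum : HasSum (fun i => (inner ℂ (v i) (v i) : ℂ).re) (inner ℂ v v : ℂ).re :=
        Complex.hasSum_re (lp.hasSum_inner v v)
      have := isLUB_hasSum (fun i => (inner_self_nonneg (𝕜 := ℂ) (x := v i) : _)) hsum
      rw [← Set.range_comp]
      have hfun : ((fun a : lp K 2 →L[ℂ] lp K 2 => (inner ℂ (a v) v : ℂ).re) ∘
          fun F : Finset I => ∑ i ∈ F, blockOperator (K := K) i 1) =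
          fun F : Finset I => ∑ i ∈ F, (inner ℂ (v i) (v i) : ℂ).re := by
        funext F
        simp only [Function.comp_apply, sum_apply, sum_inner, inner_blockOperator, Complex.re_sum,
          one_apply_eq_self]
      rw [hfun]
      exact this
  refine ⟨?_, fun b hb => key.2 ?_⟩
  · rintro _ ⟨F, rfl⟩
    change ((∑ i ∈ F, centralProjection A i : (product A).toStarSubalgebra) :
      lp K 2 →L[ℂ] lp K 2) ≤ 1
    rw [hval]
    exact key.1 ⟨F, rfl⟩
  · rintro _ ⟨F, rfl⟩
    change (∑ i ∈ F, blockOperator (K := K) i 1) ≤ _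
    rw [← hval]
    exact hb ⟨F, rfl⟩

namespace NormalModule

variable {H : Type u} [NormedAddCommGroup H] [InnerProductSpace ℂ H] [CompleteSpace H]

/-- Otherwise normality would carry the vanishing on finite sums to their supremum 1, where the
state takes the value `‖v‖²`. -/
theorem exists_vectorState_centralProjection_ne_zero (M : NormalModule H (product A)) {v : H}
    (hv : v ≠ 0) : ∃ i, M.vectorState v (centralProjection A i) ≠ 0 := by
  by_contra! h
  have hmono : Monotone fun F : Finset I => ∑ i ∈ F, centralProjection A i := fun F G hFG => by
    classical
    rw [← sub_nonneg]
    change (0 : (product A).toStarSubalgebra) ≤ (∑ i ∈ G, _) - ∑ i ∈ F, _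
    rw [← Finset.sum_sdiff hFG, add_sub_cancel_right]
    change (0 : lp K 2 →L[ℂ] lp K 2) ≤ (∑ i ∈ G \ F, centralProjection A i :)
    rw [AddSubmonoidClass.coe_finsetSum]
    exact Finset.sum_nonneg fun i _ => centralProjection_nonneg (A := A) i
  have hl := M.isLUB_vectorState v (Set.range_nonempty _) hmono.directed_le.directedOn_range
    (by
      rintro _ ⟨F, rfl⟩
      simpa using hmono F.empty_subset) isLUB_sum_centralProjection
  have h0 : M.vectorState v 1 ≤ 0 := hl.2 (by
    rintro _ ⟨_, ⟨F, rfl⟩, rfl⟩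
    simp [h])
  rw [vectorState_apply, map_one] at h0
  have h1 : RCLike.re (inner ℂ v v) ≤ 0 := h0
  rw [inner_self_eq_norm_sq] at h1
  exact hv (norm_eq_zero.1 (sq_eq_zero_iff.1 (le_antisymm h1 (sq_nonneg _))))

theorem IsKappaSmall.isKappaSeparableHilbert_of_product {κ : Cardinal.{u}} (hκ : κ.IsRegular)
    (hA : ∀ i, (A i).IsKappaSeparable κ) {M : NormalModule H (product A)}
    (hM : M.IsKappaSmall κ) : IsKappaSeparableHilbert κ H := by
  obtain ⟨J, ι', hJ, hι', hb⟩ := hM.exists_hilbertBasis (· < κ) fun v hv => by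
    obtain ⟨i, hi⟩ := M.exists_vectorState_centralProjection_ne_zero hv
    obtain ⟨L, _, _, _, R, hR, ι, hι, ⟨b⟩⟩ := hA i
    obtain ⟨a, ha, ι', hι', hb'⟩ := M.exists_hilbertBasis_cyclic_action R.pullback
      (centralProjection_nonneg i) (fun a ha hai h => eq_zero_of_le_centralProjection ha hai
        (hR ((show R.action (productProj A i a) = 0 from h).trans (map_zero R.action).symm))) hi b
    exact ⟨a, ha, ι', hι'.trans_lt hι, hb'⟩
  refine ⟨_, ?_, hb⟩
  rw [Cardinal.mk_sigma]
  -- Each dimension is below `κ`, but with no common bound below `κ`; regularity is needed here.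
  exact Cardinal.sum_lt_of_isRegular hκ hJ hι'

end NormalModule

end Product

end VonNeumannAlgebra

theorem mainTheorem12 (κ : Cardinal.{u}) (hκ : ℵ₀ ≤ κ) :
    (∀ (K : Type u) [NormedAddCommGroup K] [InnerProductSpace ℂ K] [CompleteSpace K]
        (A : VonNeumannAlgebra K), A.IsKappaSeparable κ →
      ∀ (H : Type u) [NormedAddCommGroup H] [InnerProductSpace ℂ H] [CompleteSpace H]
        (M : VonNeumannAlgebra.NormalModule H A),
        M.IsKappaSmall κ ↔ IsKappaSeparableHilbert κ H) ∧
    (∀ (I : Type u) (K : I → Type u) [∀ i, NormedAddCommGroup (K i)]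
        [∀ i, InnerProductSpace ℂ (K i)] [∀ i, CompleteSpace (K i)]
        (A : ∀ i, VonNeumannAlgebra (K i)), (∀ i, (A i).IsKappaSeparable κ) →
      ∀ (H : Type u) [NormedAddCommGroup H] [InnerProductSpace ℂ H] [CompleteSpace H]
        (M : VonNeumannAlgebra.NormalModule H (VonNeumannAlgebra.product A)),
        (IsKappaSeparableHilbert κ H → M.IsKappaSmall κ) ∧
        (κ.IsRegular → M.IsKappaSmall κ → IsKappaSeparableHilbert κ H)) :=
  ⟨fun _ _ _ _ _ hA _ _ _ _ M =>
    ⟨fun hM => hM.isKappaSeparableHilbert hκ hA,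
      fun hH => M.endAlgebra.isKappaSeparable_of_isKappaSeparableHilbert hH⟩,
    fun _ _ _ _ _ _ hA _ _ _ _ M =>
    ⟨fun hH => M.endAlgebra.isKappaSeparable_of_isKappaSeparableHilbert hH,
      fun hreg hM => hM.isKappaSeparableHilbert_of_product hreg hA⟩⟩
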